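/- **Setting.** A base station (BS) of height $h_B>0$ serves, on one side of a road, the coverage cell $[0,d_a]$, $d_a>0$. Fix $k\ge1$ and let $\theta_k=\arctan(d_a/h_B)/k$. The $j$-th of the $k$ BS beams ($1\le j\le k$) covers the ground interval $[d_{L_{jk}},d_{R_{jk}})$ with $d_{L_{jk}}=h_B\tan((j-1)\theta_k)$ and $d_{R_{jk}}=h_B\tan(j\theta_k)$. The user has $M=2\pi/\theta_U$ beams of width $\theta_U$; for $0\le m<M$ the main lobe of beam $m$ is $[m\theta_U,(m+1)\theta_U)$, with axis $(m+\tfrac12)\theta_U$. In its main lobe a beam of width $\theta$ has gain $\gamma(\theta)=G_0\frac{2\pi-(2\pi-\theta)\epsilon}{\theta}$, elsewhere $g=G_0\epsilon$, where $G_0>0$, $0<\epsilon<1$. The distance $d$ of the user is uniform on $[0,d_a]$ (density $f_d$) and its angle of arrival $\psi$ (AoA) is uniform on $[0,2\pi]$ (density $f$). The distances to the BSs of both sides of the road form a Poisson process of intensity $2\lambda$ on $(0,\infty)$, $\lambda>0$; those farther than $d$ interfere, at distances $d_i$. A link of length $r$ has path-loss exponent $\alpha(r)=\alpha_L$ if $r\le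 d_S$ (LOS) and $\alpha_N$ otherwise (NLOS), and a fading power of mean one, Gamma distributed with shape $N_L$ resp. $N_N$ (integers $\ge1$). Distance, AoA, Poisson process and all the fading powers are independent. With positive transmit power $P_t$, path-loss coefficient $K$, noise density $N_0$ and bandwidth $B$, a user at distance $x$ with total antenna gain $G$ on the serving link has $$\mathrm{SNR}=\frac{KP_t|f_0|^2G(h_B^2+x^2)^{-\alpha(x)/2}}{N_0B},\qquad \mathrm{SINR}=\frac{KP_t|f_0|^2G(h_B^2+x^2)^{-\alpha(x)/2}}{N_0B+\sum_{d_i>x}KP_t|f_i|^2g^2(h_B^2+d_i^2)^{-\alpha(d_i)/2}} .$$ Assume $d_S,\alpha_L>0$ and $N_N(\alpha_N-1)>1$. Exhaustive search selects, among all $kM$ beam pairs, a pair with the largest SNR. For a user at distance $x\in[d_{L_{jk}},d_{R_{jk}})$ with AoA $\psi$, $\mathcal P_{BS,j,k}(x,\psi)$ is the probability that a BS beam other than $j$ is selected, and $\mathcal P_{MA,j,k}(x,\psi)$ the probability that $|\psi-\hat\psi|\ge\nu(\theta_k,\theta_U)$, where $\hat\psi$ is the axis of the selected user beam and the threshold satisfies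 $\nu(\theta_k,\theta_U)\ge\theta_U/2$. For $T>0$ let $\mathcal P_C(T,j,\theta_k,\theta_U)$ be the probability that $d\in[d_{L_{jk}},d_{R_{jk}})$ and that the SINR with the selected beams is at least $T$. For functions $\mathcal T_0,\mathcal T_{MA},\mathcal T_{BS}$ of $x$ and $T$ put $$\mathcal M[\mathcal T_0,\mathcal T_{MA},\mathcal T_{BS}]=\int_0^{2\pi}\!\!\int_{d_{L_{jk}}}^{d_{R_{jk}}}\Big[\mathcal P_{BS,j,k}\mathcal T_{BS}+(1-\mathcal P_{BS,j,k})\big((1-\mathcal P_{MA,j,k})\mathcal T_0+\mathcal P_{MA,j,k}\mathcal T_{MA}\big)\Big]f_d(x)f(\psi)\,dx\,d\psi .$$ **Proposition (exhaustive search).** For exhaustive search: 1. There is no beam-selection error: $\mathcal P_{BS,j,k}(x,\psi)=0$ for all $x\in[d_{L_{jk}},d_{R_{jk}})$ and $\psi\in[0,2\pi)$. 2. There is no misalignment error: $\mathcal P_{MA,j,k}(x,\psi)=0$ for all such $x,\psi$; if $\nu(\theta_k,\theta_U)=\theta_U/2$ exactly, the finitely many angles $\psi=m\theta_U$ at which two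 user beams meet are excepted. 3. Let $\mathcal T_0,\mathcal T_{MA},\mathcal T_{BS}$ be the probabilities that the SINR of a user at distance $x$ is at least $T$ when the total serving gain is $\gamma(\theta_k)\gamma(\theta_U)$, $\gamma(\theta_k)g$ and $g^2$ respectively. Then $$\mathcal P_C(T,j,\theta_k,\theta_U)=\mathcal M[\mathcal T_0,\mathcal T_{MA},\mathcal T_{BS}]=\int_0^{2\pi}\!\!\int_{d_{L_{jk}}}^{d_{R_{jk}}}\mathcal T_0(x,T)\,f_d(x)f(\psi)\,dx\,d\psi .$$ 4. The identity $\mathcal M[\mathcal T_0,\mathcal T_{MA},\mathcal T_{BS}]=\int_0^{2\pi}\int_{d_{L_{jk}}}^{d_{R_{jk}}}\mathcal T_0 f_d f\,dx\,d\psi$ holds likewise for the closed-form expressions $\mathcal T_0=\mathcal F(\gamma(\theta_k)\gamma(\theta_U),g^2,\gamma(\theta_k)\gamma(\theta_U))$, $\mathcal T_{MA}=\mathcal F(\gamma(\theta_k)g,g,\gamma(\theta_k))$, $\mathcal T_{BS}=\mathcal F(g^2,1,1)$, where, with $z=\sqrt{x^2+h_B^2}$, $q=\sqrt{y^2+h_B^2}$,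 $\eta_L=N_L(N_L!)^{-1/N_L}$, $$\mathcal F(G,a,b)=\sum_{n=1}^{N_L}(-1)^{n+1}\binom{N_L}{n}\exp\Big(-\Big(\frac{n\eta_LTN_0}{P_tKGz^{-\alpha_L}}+\mathcal A_L+\mathcal A_{N}\Big)\Big),$$ $$\mathcal A_L=2\lambda\int_x^{d_S}1-\frac1{\Big(1+\frac{\eta_LTa\,q^{-\alpha_L}\,2\lambda y}{N_L\,b\,z^{-\alpha_L}}\Big)^{N_L}}\,dy,\qquad \mathcal A_{N}=2\lambda\int_{d_S}^\infty1-\frac1{1+\Big(\frac{\eta_LTa\,q^{-\alpha_N}\,2\lambda(y-d_S)}{N_N\,b\,z^{-\alpha_L}+n\eta_LTg^2q^{-\alpha_N}}\Big)^{N_N}}\,dy .$$ -/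

import Mathlib

open MeasureTheory ProbabilityTheory Set
open scoped ENNReal Nat

noncomputable section

namespace MmWave

/-- Parameters of the roadside mm-wave network, seen from one side of a base station (BS) whose
coverage cell on that side has length `da`. -/
structure Network where
  /-- height of the BSs -/
  hB : ℝ
  /-- transmit power -/
  Pt : ℝ
  /-- path-loss coefficient -/
  K : ℝ
  /-- noise power spectral density (linear units) -/
  N0 : ℝ
  /-- bandwidth -/
  B : ℝ
  /-- gain of the omnidirectional antenna -/
  G0 : ℝ
  /-- relative side-lobe level -/
  eps : ℝ
  /-- intensity of the BS process -/
  lam : ℝ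
  /-- radius of the line-of-sight (LOS) ball -/
  dS : ℝ
  /-- LOS path-loss exponent -/
  αL : ℝ
  /-- non-line-of-sight (NLOS) path-loss exponent -/
  αN : ℝ
  /-- Nakagami parameter of the LOS links -/
  NL : ℕ
  /-- Nakagami parameter of the NLOS links -/
  NN : ℕ
  /-- length of the coverage cell -/
  da : ℝ
  hB_pos : 0 < hB
  Pt_pos : 0 < Pt
  K_pos : 0 < K
  N0_pos : 0 < N0
  B_pos : 0 < B
  G0_pos : 0 < G0
  eps_pos : 0 < eps
  eps_lt_one : eps < 1
  lam_pos : 0 < lam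
  dS_pos : 0 < dS
  αL_pos : 0 < αL
  NL_pos : 1 ≤ NL
  NN_pos : 1 ≤ NN
  /-- far-field decay: the total NLOS interference is finite and the improper integrals in the
  coverage formulas converge (it holds for instance as soon as `2 < αN`) -/
  αN_decay : 1 < NN * (αN - 1)
  da_pos : 0 < da

variable (S : Network)

/-! ### Beams -/

/-- Side-lobe gain. -/
def sideGain : ℝ := S.G0 * S.eps

/-- Main-lobe gain of a beam of width `θ`. -/
def mainGain (θ : ℝ) : ℝ :=
  S.G0 * ((2 * Real.pi - (2 * Real.pi - θ) * S.eps) / θ)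

/-- Width of the single BS beam that covers the whole cell `[0, da]`. -/
def theta1 : ℝ := Real.arctan (S.da / S.hB) - Real.arctan (0 / S.hB)

/-- Width of the beams of the BS dictionary of size `k`. -/
def thetaB (k : ℕ) : ℝ := theta1 S / k

/-- Left end of the ground interval covered by the beam number `j` (counted from `0`) of the
dictionary of size `k`: consecutive adjacent beams of width `thetaB S k`, the first of which starts
at `0`. -/
def dL (k j : ℕ) : ℝ := S.hB * Real.tan (j * thetaB S k)

/-- Right end of the ground interval covered by the beam number `j` (counted from `0`). -/
def dR (k j : ℕ) : ℝ := S.hB * Real.tan (Real.arctan (dL S k j / S.hB) + thetaB S k)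

/-- Ground interval covered by the main lobe of beam `j`; half-open, so that the main lobes of one
dictionary do not overlap. -/
def cell (k j : ℕ) : Set ℝ := Ico (dL S k j) (dR S k j)

/-- Width of the beams of a user-side codebook with `M` beams. -/
def thetaU (M : ℕ) : ℝ := 2 * Real.pi / M

/-- Main lobe (in terms of the angle of arrival) of the user beam number `m` (from `0`). -/
def lobeU (M m : ℕ) : Set ℝ := Ico (m * thetaU M) ((m + 1) * thetaU M)

/-- Axis of the main lobe of the user beam number `m`. -/
def axisU (M m : ℕ) : ℝ := (m + 1 / 2) * thetaU M

open Classical in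
/-- Sectorized BS gain of beam `j` towards a user at distance `x`. -/
def gainB (k j : ℕ) (x : ℝ) : ℝ :=
  if x ∈ cell S k j then mainGain S (thetaB S k) else sideGain S

open Classical in
/-- Sectorized user gain of beam `m` for a signal with angle of arrival `ψ`. -/
def gainU (M m : ℕ) (ψ : ℝ) : ℝ :=
  if ψ ∈ lobeU M m then mainGain S (thetaU M) else sideGain S

/-! ### Location of the user, fading and interfering base stations -/

/-- Density of the distance of the user, uniform in the cell. -/
def fd (x : ℝ) : ℝ := if 0 ≤ x ∧ x ≤ S.da then S.da⁻¹ else 0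

/-- Density of the angle of arrival, uniform between `0` and `2π`. -/
def fpsi (ψ : ℝ) : ℝ := if 0 ≤ ψ ∧ ψ ≤ 2 * Real.pi then (2 * Real.pi)⁻¹ else 0

/-- Law of the distance of the user. -/
def distLaw : Measure ℝ := volume.withDensity fun x => ENNReal.ofReal (fd S x)

/-- Law of the angle of arrival. -/
def aoaLaw : Measure ℝ := volume.withDensity fun ψ => ENNReal.ofReal (fpsi ψ)

/-- A realization of the propagation environment: the successive gaps between the points of a
point process on `(0, ∞)`, and the sequences of LOS and of NLOS fading powers. -/
abbrev Env : Type := (ℕ → ℝ) × (ℕ → ℝ) × (ℕ → ℝ)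

/-- Law of the environment. The gaps are independent exponential variables with rate `2λ`, so that
the points form the Poisson process of distances to the BSs of both sides of the road. The fading
powers `|f|²` are independent, of mean one, and Gamma distributed (Nakagami fading). -/
def envLaw : Measure Env :=
  (Measure.infinitePi fun _ : ℕ => expMeasure (2 * S.lam)).prod
    ((Measure.infinitePi fun _ : ℕ => gammaMeasure S.NL S.NL).prod
      (Measure.infinitePi fun _ : ℕ => gammaMeasure S.NN S.NN))

/-- Distance of the `i`-th point of the process. -/
def bsDist (e : Env) (i : ℕ) : ℝ := ∑ l ∈ Finset.range (i + 1), e.1 l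

/-- Path-loss exponent of a link of length `r` in the LOS ball model. -/
def pathExp (r : ℝ) : ℝ := if r ≤ S.dS then S.αL else S.αN

/-- Fading power of link `i` (number `0` is the serving link) when its length is `r`. -/
def fading (e : Env) (i : ℕ) (r : ℝ) : ℝ := if r ≤ S.dS then e.2.1 i else e.2.2 i

/-- Received power over link `i` of length `r` with total antenna gain `G`. -/
def rxPower (e : Env) (i : ℕ) (r G : ℝ) : ℝ :=
  S.K * S.Pt * fading S e i r * G * (S.hB ^ 2 + r ^ 2) ^ (-(pathExp S r) / 2)

/-- SNR on the serving link (no interference), for a user at distance `x` and total gain `G`. -/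
def snr (x : ℝ) (e : Env) (G : ℝ) : ℝ := rxPower S e 0 x G / (S.N0 * S.B)

open Classical in
/-- Interference at a user at distance `x` from its serving BS. The serving BS is the closest one,
so the interfering BSs are the points of the process that lie farther than `x`. -/
def interference (x : ℝ) (e : Env) : ℝ≥0∞ :=
  ∑' i : ℕ, if x < bsDist e i then
    ENNReal.ofReal (rxPower S e (i + 1) (bsDist e i) (sideGain S ^ 2)) else 0

/-- SINR in the data phase, for a user at distance `x` and total serving gain `G`. -/
def sinr (x : ℝ) (e : Env) (G : ℝ) : ℝ≥0∞ :=
  ENNReal.ofReal (rxPower S e 0 x G) / (ENNReal.ofReal (S.N0 * S.B) + interference S x e)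

/-- Probability that the SINR is at least `T`, given that the user is at distance `x` and that the
total antenna gain on the serving link is `G`. -/
def condCoverage (T G x : ℝ) : ℝ := (envLaw S).real {e | ENNReal.ofReal T ≤ sinr S x e G}

/-! ### Beam selection -/

/-- A beam-selection rule: the pair (BS beam, user beam) selected when the user is at distance `x`
with angle of arrival `ψ` in the environment `e`. -/
abbrev Selection (k M : ℕ) : Type := ℝ → ℝ → Env → Fin k × Fin M

/-- Exhaustive search: among all the beam pairs, one with the largest SNR is selected. -/
def IsExhaustiveSearch {k M : ℕ} (sel : Selection k M) : Prop :=
  ∀ (x ψ : ℝ) (e : Env) (p : Fin k × Fin M),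
    snr S x e (gainB S k p.1 x * gainU S M p.2 ψ) ≤
      snr S x e (gainB S k (sel x ψ e).1 x * gainU S M (sel x ψ e).2 ψ)

/-- Probability of a beam-selection error, for a user at distance `x` in the ground interval of
beam `j` and with angle of arrival `ψ`: another BS beam than `j` is allotted to the user. -/
def probBS {k M : ℕ} (sel : Selection k M) (j : Fin k) (x ψ : ℝ) : ℝ :=
  (envLaw S).real {e | (sel x ψ e).1 ≠ j}

/-- Probability of a misalignment error with angular threshold `ν`: the axis of the user beam
deviates from the angle of arrival by at least `ν`. -/
def probMA {k M : ℕ} (sel : Selection k M) (ν x ψ : ℝ) : ℝ :=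
  (envLaw S).real {e | ν ≤ |ψ - axisU M (sel x ψ e).2|}

/-- SINR coverage probability of the typical user served in the ground interval of beam `j`: the
probability that the user is located there and that its SINR, with the selected beam pair, is at
least `T`. -/
def coverage {k M : ℕ} (sel : Selection k M) (T : ℝ) (j : Fin k) : ℝ :=
  ((distLaw S).prod (aoaLaw.prod (envLaw S))).real
    {w | w.1 ∈ cell S k j ∧ ENNReal.ofReal T ≤
      sinr S w.1 w.2.2
        (gainB S k (sel w.1 w.2.1 w.2.2).1 w.1 * gainU S M (sel w.1 w.2.1 w.2.2).2 w.2.1)}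

/-! ### The coverage formula -/

/-- The coverage formula: the mixture of the coverage probabilities `T0` (no error), `TMA`
(misalignment only) and `TBS` (beam-selection error), weighted with the error probabilities `PBS`
and `PMA`, and averaged over the distance and the angle of arrival. -/
def mixture (k j : ℕ) (T0 TMA TBS : ℝ → ℝ) (PBS PMA : ℝ → ℝ → ℝ) : ℝ :=
  ∫ ψ in (0 : ℝ)..(2 * Real.pi), ∫ x in (dL S k j)..(dR S k j),
    (PBS x ψ * TBS x + (1 - PBS x ψ) * ((1 - PMA x ψ) * T0 x + PMA x ψ * TMA x))
      * fd S x * fpsi ψ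

/-- The integral of `T0` alone over the distance and the angle of arrival. -/
def errorFree (k j : ℕ) (T0 : ℝ → ℝ) : ℝ :=
  ∫ ψ in (0 : ℝ)..(2 * Real.pi), ∫ x in (dL S k j)..(dR S k j), T0 x * fd S x * fpsi ψ

/-- Length of the link to a BS at horizontal distance `x`. -/
def slant (x : ℝ) : ℝ := Real.sqrt (x ^ 2 + S.hB ^ 2)

/-- `η_L = N_L (N_L!)^(-1/N_L)`. -/
def etaL : ℝ := S.NL * ((S.NL ! : ℕ) : ℝ) ^ (-(1 : ℝ) / S.NL)

/-- LOS interference exponent, `a` and `b` being the gain factors of the interfering and of the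
serving links. -/
def expoL (T a b x : ℝ) : ℝ :=
  2 * S.lam * ∫ y in x..S.dS,
    (1 - 1 / (1 + etaL S * T * a * slant S y ^ (-S.αL) * (2 * S.lam * y) /
      (S.NL * b * slant S x ^ (-S.αL))) ^ S.NL)

/-- NLOS interference exponent in the `n`-th term of the coverage formula. -/
def expoN (n : ℕ) (T a b x : ℝ) : ℝ :=
  2 * S.lam * ∫ y in Ioi S.dS,
    (1 - 1 / (1 + (etaL S * T * a * slant S y ^ (-S.αN) * (2 * S.lam * (y - S.dS)) /
      (S.NN * b * slant S x ^ (-S.αL) +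
        n * etaL S * T * sideGain S ^ 2 * slant S y ^ (-S.αN))) ^ S.NN))

/-- Coverage at distance `x` when the total serving gain is `G`. -/
def covFormula (T G a b x : ℝ) : ℝ :=
  ∑ n ∈ Finset.Icc 1 S.NL, (-1 : ℝ) ^ (n + 1) * (S.NL.choose n : ℝ) *
    Real.exp (-(n * etaL S * T * S.N0 / (S.Pt * S.K * G * slant S x ^ (-S.αL)) +
      expoL S T a b x + expoN S n T a b x))

/-- Serving gain without any error. -/
def gain0 (θB θU : ℝ) : ℝ := mainGain S θB * mainGain S θU

/-- Serving gain with a misalignment error only. -/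
def gainMA (θB : ℝ) : ℝ := mainGain S θB * sideGain S

/-- Serving gain with a beam-selection error. -/
def gainBS : ℝ := sideGain S ^ 2

/-- Closed form of the coverage without any error. -/
def formula0 (T θB θU : ℝ) : ℝ → ℝ :=
  covFormula S T (gain0 S θB θU) (sideGain S ^ 2) (mainGain S θB * mainGain S θU)

/-- Closed form of the coverage with a misalignment error only. -/
def formulaMA (T θB : ℝ) : ℝ → ℝ :=
  covFormula S T (gainMA S θB) (sideGain S) (mainGain S θB)

/-- Closed form of the coverage with a beam-selection error. -/
def formulaBS (T : ℝ) : ℝ → ℝ := covFormula S T (gainBS S) 1 1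

end MmWave

end

noncomputable section

namespace MmWave

variable (S : Network)

/-! ### Geometry of the beams -/

/-! For a fixed user and environment, the SNR of a beam pair is a constant times the product of two
gains, and the constant is positive as soon as the serving fading is nonzero. Each gain takes only
two values, side lobe < main lobe, so the product is maximal exactly when both main lobes are hit.
The cells are disjoint, which forces the BS beam, and the user lobes cover all angles, so an aligned
pair exists (`IsExhaustiveSearch.selected`). If the fading vanishes, all pairs tie and the choice is
arbitrary, but Gamma laws give this probability zero (`ae_fading_pos`). Hence both error
probabilities vanish off boundary angles, and the mixture collapses for arbitrary `T0`, `TMA`,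
`TBS`. In the coverage event the selected gain is almost surely the constant `gain0`; Tonelli then
gives the integral over distance and angle. -/

lemma sideGain_pos : 0 < sideGain S := mul_pos S.G0_pos S.eps_pos

/-- Once the denominator `θ` is cleared, the gap is exactly `2π(1 - ε)`, whatever the width. -/
lemma sideGain_lt_mainGain {θ : ℝ} (hθ : 0 < θ) : sideGain S < mainGain S θ := by
  have h : 0 < 2 * Real.pi * (1 - S.eps) :=
    mul_pos Real.two_pi_pos (sub_pos.2 S.eps_lt_one)
  refine mul_lt_mul_of_pos_left ?_ S.G0_pos
  rw [lt_div_iff₀ hθ]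
  linarith

lemma theta1_pos : 0 < theta1 S := by
  simp [theta1, div_pos S.da_pos S.hB_pos]

lemma theta1_lt_pi_div_two : theta1 S < Real.pi / 2 := by
  simpa [theta1] using Real.arctan_lt_pi_div_two (S.da / S.hB)

lemma thetaB_pos {k : ℕ} (hk : 0 < k) : 0 < thetaB S k :=
  div_pos (theta1_pos S) (Nat.cast_pos.2 hk)

lemma natCast_mul_thetaB_le {k j : ℕ} (hj : j ≤ k) : j * thetaB S k ≤ theta1 S := by
  rcases Nat.eq_zero_or_pos k with rfl | hk
  · simpa [thetaB] using (theta1_pos S).le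
  have hk' : (0 : ℝ) < k := Nat.cast_pos.2 hk
  rw [thetaB, mul_div_assoc', div_le_iff₀ hk', mul_comm]
  exact mul_le_mul_of_nonneg_left (Nat.cast_le.2 hj) (theta1_pos S).le

/-- Keeps all beam edges in the principal branch, where `tan` is increasing and inverted by
`arctan`. -/
lemma natCast_mul_thetaB_mem {k j : ℕ} (hk : 0 < k) (hj : j ≤ k) :
    j * thetaB S k ∈ Ioo (-(Real.pi / 2)) (Real.pi / 2) :=
  ⟨(neg_lt_zero.2 (half_pos Real.pi_pos)).trans_le
      (mul_nonneg j.cast_nonneg (thetaB_pos S hk).le),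
    (natCast_mul_thetaB_le S hj).trans_lt (theta1_lt_pi_div_two S)⟩

lemma dR_eq_dL_succ {k j : ℕ} (hj : j < k) : dR S k j = dL S k (j + 1) := by
  have h := natCast_mul_thetaB_mem S (Nat.zero_lt_of_lt hj) hj.le
  rw [dR, dL, mul_div_cancel_left₀ _ S.hB_pos.ne', Real.arctan_tan h.1 h.2, dL]
  congr 2
  push_cast
  ring

lemma dL_le_dL {k i j : ℕ} (hk : 0 < k) (hij : i ≤ j) (hj : j ≤ k) :
    dL S k i ≤ dL S k j :=
  mul_le_mul_of_nonneg_left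
    (Real.strictMonoOn_tan.monotoneOn (natCast_mul_thetaB_mem S hk (hij.trans hj))
      (natCast_mul_thetaB_mem S hk hj)
      (mul_le_mul_of_nonneg_right (Nat.cast_le.2 hij) (thetaB_pos S hk).le)) S.hB_pos.le

lemma dL_le_dR {k j : ℕ} (hj : j < k) : dL S k j ≤ dR S k j :=
  (dL_le_dL S (Nat.zero_lt_of_lt hj) j.le_succ hj).trans_eq (dR_eq_dL_succ S hj).symm

/-- The ground intervals of the beams of one dictionary are disjoint. -/
lemma eq_of_mem_cell {k i j : ℕ} (hi : i < k) (hj : j < k) {x : ℝ} (hxi : x ∈ cell S k i)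
    (hxj : x ∈ cell S k j) : i = j := by
  -- The lower-numbered cell ends, exclusively, at `dL (a + 1) ≤ dL b`.
  have key : ∀ {a b : ℕ}, a < k → b < k → x ∈ cell S k a → x ∈ cell S k b → ¬ a < b := by
    intro a b ha hb hxa hxb hab
    have h1 := hxa.2
    rw [dR_eq_dL_succ S ha] at h1
    exact (h1.trans_le (dL_le_dL S (Nat.zero_lt_of_lt hb) hab hb.le)).not_ge hxb.1
  exact le_antisymm (not_lt.1 (key hj hi hxj hxi)) (not_lt.1 (key hi hj hxi hxj))

lemma thetaU_pos {M : ℕ} (hM : 0 < M) : 0 < thetaU M :=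
  div_pos Real.two_pi_pos (Nat.cast_pos.2 hM)

/-- The main lobes of the user beams cover all the angles of arrival. -/
lemma exists_mem_lobeU {M : ℕ} (hM : 0 < M) {ψ : ℝ} (hψ : ψ ∈ Ico (0 : ℝ) (2 * Real.pi)) :
    ∃ m : Fin M, ψ ∈ lobeU M m := by
  have hθ := thetaU_pos hM
  have hM' : (M : ℝ) ≠ 0 := Nat.cast_ne_zero.2 hM.ne'
  have h0 : 0 ≤ ψ / thetaU M := div_nonneg hψ.1 hθ.le
  -- The lobe index is the floor of `ψ / thetaU M`; it is below `M` because `M * thetaU M = 2π`.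
  have hlt : ⌊ψ / thetaU M⌋₊ < M := by
    rw [Nat.floor_lt h0, div_lt_iff₀ hθ, thetaU, mul_div_cancel₀ _ hM']
    exact hψ.2
  exact ⟨⟨_, hlt⟩, (le_div_iff₀ hθ).1 (Nat.floor_le h0),
    (div_lt_iff₀ hθ).1 (Nat.lt_floor_add_one _)⟩

lemma abs_sub_axisU_le {M m : ℕ} {ψ : ℝ} (h : ψ ∈ lobeU M m) :
    |ψ - axisU M m| ≤ thetaU M / 2 := by
  have h1 := h.1
  have h2 := h.2
  rw [axisU, abs_le]
  constructor <;> linarith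

/-- In a half-open lobe only the left end lies half a beamwidth away from the axis. -/
lemma abs_sub_axisU_lt {M m : ℕ} {ψ : ℝ} (h : ψ ∈ lobeU M m) (hne : ψ ≠ m * thetaU M) :
    |ψ - axisU M m| < thetaU M / 2 := by
  have h1 := lt_of_le_of_ne h.1 hne.symm
  have h2 := h.2
  rw [axisU, abs_lt]
  constructor <;> linarith

/-! ### Outcome of exhaustive search -/

lemma gainU_pos {M : ℕ} (hM : 0 < M) (m : ℕ) (ψ : ℝ) : 0 < gainU S M m ψ := by
  have h := sideGain_pos S
  unfold gainU
  split_ifs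
  exacts [h.trans (sideGain_lt_mainGain S (thetaU_pos hM)), h]

lemma gainU_le {M : ℕ} (hM : 0 < M) (m : ℕ) (ψ : ℝ) :
    gainU S M m ψ ≤ mainGain S (thetaU M) := by
  unfold gainU
  split_ifs
  exacts [le_rfl, (sideGain_lt_mainGain S (thetaU_pos hM)).le]

lemma gainB_le {k : ℕ} (hk : 0 < k) (j : ℕ) (x : ℝ) :
    gainB S k j x ≤ mainGain S (thetaB S k) := by
  unfold gainB
  split_ifs
  exacts [le_rfl, (sideGain_lt_mainGain S (thetaB_pos S hk)).le]

/-- With nonzero fading on the serving link, exhaustive search selects the beams whose main lobes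
contain the user and the angle of arrival. -/
lemma IsExhaustiveSearch.selected {S : Network} {k M : ℕ} {sel : Selection k M}
    (hsel : IsExhaustiveSearch S sel) {j : Fin k} {x ψ : ℝ} (hx : x ∈ cell S k j)
    (hψ : ψ ∈ Ico (0 : ℝ) (2 * Real.pi)) {e : Env} (hL : 0 < e.2.1 0) (hN : 0 < e.2.2 0) :
    (sel x ψ e).1 = j ∧ ψ ∈ lobeU M (sel x ψ e).2 := by
  have hk : 0 < k := j.pos
  have hM : 0 < M := (sel x ψ e).2.pos
  obtain ⟨m, hm⟩ := exists_mem_lobeU hM hψ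
  have hside := sideGain_pos S
  have hB := sideGain_lt_mainGain S (thetaB_pos S hk)
  have hU := sideGain_lt_mainGain S (thetaU_pos hM)
  have hf : 0 < fading S e 0 x := by
    unfold fading
    split_ifs
    exacts [hL, hN]
  have hbase : 0 < S.hB ^ 2 + x ^ 2 := add_pos_of_pos_of_nonneg (pow_pos S.hB_pos 2) (sq_nonneg x)
  have hc : 0 < S.K * S.Pt * fading S e 0 x *
      (S.hB ^ 2 + x ^ 2) ^ (-(pathExp S x) / 2) / (S.N0 * S.B) :=
    div_pos (mul_pos (mul_pos (mul_pos S.K_pos S.Pt_pos) hf) (Real.rpow_pos_of_pos hbase _))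
      (mul_pos S.N0_pos S.B_pos)
  have hsnr : ∀ G, snr S x e G = S.K * S.Pt * fading S e 0 x *
      (S.hB ^ 2 + x ^ 2) ^ (-(pathExp S x) / 2) / (S.N0 * S.B) * G := by
    intro G
    simp only [snr, rxPower]
    ring
  -- The aligned pair is the competitor; dividing by the positive constant leaves a comparison of
  -- gain products.
  have hmax := hsel x ψ e (j, m)
  rw [hsnr, hsnr, mul_le_mul_iff_right₀ hc] at hmax
  have hgB : gainB S k j x = mainGain S (thetaB S k) := if_pos hx
  have hgU : gainU S M m ψ = mainGain S (thetaU M) := if_pos hm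
  simp only [hgB, hgU] at hmax
  constructor
  · by_contra hne
    have hout : x ∉ cell S k (sel x ψ e).1 := fun h =>
      hne (Fin.ext (eq_of_mem_cell S (sel x ψ e).1.2 j.2 h hx))
    have hg : gainB S k (sel x ψ e).1 x = sideGain S := if_neg hout
    rw [hg] at hmax
    -- A wrong BS beam loses strictly in the first factor and cannot gain in the second, whichever
    -- user beam goes with it.
    exact absurd hmax (not_le.2 (mul_lt_mul hB (gainU_le S hM _ _) (gainU_pos S hM _ _)
      (hside.trans hB).le))
  · by_contra hout
    have hg : gainU S M (sel x ψ e).2 ψ = sideGain S := if_neg hout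
    rw [hg] at hmax
    exact absurd hmax (not_le.2 (mul_lt_mul' (gainB_le S hk _ _) hU hside.le (hside.trans hB)))

/-! ### The environment -/

instance isProbabilityMeasure_exp_rate : IsProbabilityMeasure (expMeasure (2 * S.lam)) :=
  isProbabilityMeasure_expMeasure (mul_pos two_pos S.lam_pos)

instance isProbabilityMeasure_gamma_NL : IsProbabilityMeasure (gammaMeasure S.NL S.NL) :=
  isProbabilityMeasure_gammaMeasure (Nat.cast_pos.2 S.NL_pos) (Nat.cast_pos.2 S.NL_pos)

instance isProbabilityMeasure_gamma_NN : IsProbabilityMeasure (gammaMeasure S.NN S.NN) :=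
  isProbabilityMeasure_gammaMeasure (Nat.cast_pos.2 S.NN_pos) (Nat.cast_pos.2 S.NN_pos)

instance isProbabilityMeasure_envLaw : IsProbabilityMeasure (envLaw S) := by
  unfold envLaw
  infer_instance

/-- The density vanishes on the negative half-line, and the point `0` is Lebesgue null. -/
lemma ae_pos_gammaMeasure (a r : ℝ) : ∀ᵐ x ∂gammaMeasure a r, 0 < x := by
  have h : gammaMeasure a r (Iic 0) = 0 := by
    rw [gammaMeasure, withDensity_apply _ measurableSet_Iic, setLIntegral_congr Iio_ae_eq_Iic.symm]
    exact lintegral_gammaPDF_of_nonpos le_rfl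
  rw [ae_iff]
  simp only [not_lt]
  exact h

lemma ae_pos_infinitePi_gammaMeasure {a r : ℝ} [IsProbabilityMeasure (gammaMeasure a r)] (i : ℕ) :
    ∀ᵐ f ∂Measure.infinitePi fun _ : ℕ => gammaMeasure a r, 0 < f i :=
  (measurePreserving_eval_infinitePi (fun _ : ℕ => gammaMeasure a r)
    i).quasiMeasurePreserving.ae (ae_pos_gammaMeasure a r)

/-- Almost surely the fading on the serving link does not vanish. -/
lemma ae_fading_pos : ∀ᵐ e ∂envLaw S, 0 < e.2.1 0 ∧ 0 < e.2.2 0 := by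
  unfold envLaw
  refine Measure.quasiMeasurePreserving_snd.ae (p := fun q : (ℕ → ℝ) × (ℕ → ℝ) =>
    0 < q.1 0 ∧ 0 < q.2 0) ?_
  exact (Measure.quasiMeasurePreserving_fst.ae (ae_pos_infinitePi_gammaMeasure 0)).and
    (Measure.quasiMeasurePreserving_snd.ae (ae_pos_infinitePi_gammaMeasure 0))

/-! ### Error probabilities -/

section Errors

variable {S} {k M : ℕ} {sel : Selection k M}

lemma IsExhaustiveSearch.probBS_eq_zero (hsel : IsExhaustiveSearch S sel) {j : Fin k} {x ψ : ℝ}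
    (hx : x ∈ cell S k j) (hψ : ψ ∈ Ico (0 : ℝ) (2 * Real.pi)) : probBS S sel j x ψ = 0 := by
  have h : ∀ᵐ e ∂envLaw S, (sel x ψ e).1 = j := by
    filter_upwards [ae_fading_pos S] with e he
    exact (hsel.selected hx hψ he.1 he.2).1
  rw [probBS, measureReal_def, ae_iff.1 h, ENNReal.toReal_zero]

lemma IsExhaustiveSearch.probMA_eq_zero (hsel : IsExhaustiveSearch S sel) {j : Fin k} {x ψ ν : ℝ}
    (hν : thetaU M / 2 ≤ ν) (hx : x ∈ cell S k j) (hψ : ψ ∈ Ico (0 : ℝ) (2 * Real.pi))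
    (h : thetaU M / 2 < ν ∨ ∀ m : ℕ, ψ ≠ m * thetaU M) : probMA S sel ν x ψ = 0 := by
  have hae : ∀ᵐ e ∂envLaw S, ¬ ν ≤ |ψ - axisU M (sel x ψ e).2| := by
    filter_upwards [ae_fading_pos S] with e he
    have hm := (hsel.selected hx hψ he.1 he.2).2
    rw [not_le]
    rcases h with h | h
    · exact (abs_sub_axisU_le hm).trans_lt h
    · exact (abs_sub_axisU_lt hm (h _)).trans_le hν
  have h0 := ae_iff.1 hae
  simp only [not_not] at h0
  rw [probMA, measureReal_def, h0, ENNReal.toReal_zero]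

/-- Under exhaustive search the coverage formula keeps only its error-free term, whatever the
conditional coverage probabilities are. -/
lemma IsExhaustiveSearch.mixture_eq_errorFree (hsel : IsExhaustiveSearch S sel) (j : Fin k) {ν : ℝ}
    (hν : thetaU M / 2 ≤ ν) (T0 TMA TBS : ℝ → ℝ) :
    mixture S k j T0 TMA TBS (probBS S sel j) (probMA S sel ν) = errorFree S k j T0 := by
  -- The angles where misalignment is not excluded are countably many, hence invisible to the
  -- integral.
  have hψ0 : ∀ᵐ ψ : ℝ, ∀ m : ℕ, ψ ≠ m * thetaU M :=
    ae_all_iff.2 fun m => Measure.ae_ne volume _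
  refine intervalIntegral.integral_congr_ae ?_
  -- Interval integrals run over `Ioc` while lobes and cells are `Ico`; the right endpoints are
  -- discarded as null sets, here and for `x` below.
  filter_upwards [hψ0, Measure.ae_ne volume (2 * Real.pi)] with ψ hψ hψ' hmem
  rw [uIoc_of_le Real.two_pi_pos.le] at hmem
  have hψI : ψ ∈ Ico (0 : ℝ) (2 * Real.pi) := ⟨hmem.1.le, lt_of_le_of_ne hmem.2 hψ'⟩
  refine intervalIntegral.integral_congr_ae ?_
  filter_upwards [Measure.ae_ne volume (dR S k j)] with x hx hxmem
  rw [uIoc_of_le (dL_le_dR S j.2)] at hxmem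
  have hxc : x ∈ cell S k j := ⟨hxmem.1.le, lt_of_le_of_ne hxmem.2 hx⟩
  rw [hsel.probBS_eq_zero hxc hψI, hsel.probMA_eq_zero hν hxc hψI (.inr hψ)]
  ring

end Errors

/-! ### The coverage probability -/

lemma measurable_fd : Measurable (fd S) :=
  Measurable.ite measurableSet_Icc measurable_const measurable_const

lemma fd_nonneg (x : ℝ) : 0 ≤ fd S x := by
  unfold fd
  split_ifs
  exacts [(inv_pos.2 S.da_pos).le, le_rfl]

lemma aoaLaw_eq :
    aoaLaw = ENNReal.ofReal (2 * Real.pi)⁻¹ • volume.restrict (Icc 0 (2 * Real.pi)) := by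
  rw [aoaLaw, ← withDensity_const, ← withDensity_indicator measurableSet_Icc]
  congr 1
  ext ψ
  by_cases h : ψ ∈ Icc 0 (2 * Real.pi)
  · rw [indicator_of_mem h, fpsi, if_pos (mem_Icc.1 h)]
  · rw [indicator_of_notMem h, fpsi, if_neg (mt mem_Icc.2 h), ENNReal.ofReal_zero]

instance isProbabilityMeasure_aoaLaw : IsProbabilityMeasure aoaLaw where
  measure_univ := by
    have h := Real.two_pi_pos
    rw [aoaLaw_eq, Measure.smul_apply, Measure.restrict_apply_univ, Real.volume_Icc, sub_zero,
      smul_eq_mul, ← ENNReal.ofReal_mul (inv_pos.2 h).le, inv_mul_cancel₀ h.ne', ENNReal.ofReal_one]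

instance sFinite_distLaw : SFinite (distLaw S) := by
  unfold distLaw
  infer_instance

lemma ae_aoaLaw_mem : ∀ᵐ ψ ∂aoaLaw, ψ ∈ Ico (0 : ℝ) (2 * Real.pi) := by
  rw [aoaLaw_eq]
  refine Measure.ae_smul_measure ?_ _
  filter_upwards [ae_restrict_mem measurableSet_Icc,
    ae_restrict_of_ae (Measure.ae_ne volume (2 * Real.pi))] with ψ h h'
  exact ⟨h.1, lt_of_le_of_ne h.2 h'⟩

lemma integral_fpsi : ∫ ψ in (0 : ℝ)..(2 * Real.pi), fpsi ψ = 1 := by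
  have h : ∀ ψ ∈ uIcc (0 : ℝ) (2 * Real.pi), fpsi ψ = (2 * Real.pi)⁻¹ := by
    intro ψ hψ
    rw [uIcc_of_le Real.two_pi_pos.le] at hψ
    exact if_pos hψ
  rw [intervalIntegral.integral_congr h, intervalIntegral.integral_const, sub_zero, smul_eq_mul,
    mul_inv_cancel₀ Real.two_pi_pos.ne']

lemma measurable_bsDist (i : ℕ) : Measurable fun e : Env => bsDist e i := by
  unfold bsDist
  fun_prop

lemma measurable_rxPower {α : Type*} [MeasurableSpace α] {r : α → ℝ} {e : α → Env}
    (hr : Measurable r) (he : Measurable e) (i : ℕ) (G : ℝ) :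
    Measurable fun a => rxPower S (e a) i (r a) G := by
  have hset : MeasurableSet {a | r a ≤ S.dS} := measurableSet_le hr measurable_const
  have hexp : Measurable fun a => pathExp S (r a) :=
    Measurable.ite hset measurable_const measurable_const
  have hfad : Measurable fun a => fading S (e a) i (r a) :=
    Measurable.ite hset (by fun_prop) (by fun_prop)
  unfold rxPower
  fun_prop

/-- Joint measurability in distance and environment is what the product-measure formula needs. -/
lemma measurable_sinr (G : ℝ) : Measurable fun p : ℝ × Env => sinr S p.1 p.2 G := by
  have hd : ∀ i, Measurable fun p : ℝ × Env => bsDist p.2 i := fun i =>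
    (measurable_bsDist i).comp measurable_snd
  have hI : Measurable fun p : ℝ × Env => interference S p.1 p.2 := by
    unfold interference
    refine Measurable.tsum fun i => Measurable.ite
      (measurableSet_lt measurable_fst (hd i)) ?_ measurable_const
    exact (measurable_rxPower S (hd i) measurable_snd _ _).ennreal_ofReal
  exact (measurable_rxPower S measurable_fst measurable_snd 0 G).ennreal_ofReal.div
    (measurable_const.add hI)

lemma measurableSet_covered (T G : ℝ) :
    MeasurableSet {p : ℝ × Env | ENNReal.ofReal T ≤ sinr S p.1 p.2 G} :=
  measurableSet_le measurable_const (measurable_sinr S G)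

/-- Probability that a user with constant serving gain is in the ground interval of beam `j` and
covered. -/
lemma measureReal_cell_covered (k j : ℕ) (T G : ℝ) :
    ((distLaw S).prod (aoaLaw.prod (envLaw S))).real
      {w | w.1 ∈ cell S k j ∧ ENNReal.ofReal T ≤ sinr S w.1 w.2.2 G} =
      ∫ x in cell S k j, condCoverage S T G x ∂distLaw S := by
  have hcell : MeasurableSet (cell S k j) := measurableSet_Ico
  have hmeas : MeasurableSet {w : ℝ × ℝ × Env | w.1 ∈ cell S k j ∧
      ENNReal.ofReal T ≤ sinr S w.1 w.2.2 G} :=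
    (measurable_fst hcell).inter
      ((measurable_fst.prodMk (measurable_snd.comp measurable_snd)) (measurableSet_covered S T G))
  -- With a constant gain the event does not involve the angle of arrival, whose law contributes a
  -- factor one.
  have hsec : ∀ x, (aoaLaw.prod (envLaw S)) (Prod.mk x ⁻¹' {w : ℝ × ℝ × Env | w.1 ∈ cell S k j ∧
      ENNReal.ofReal T ≤ sinr S w.1 w.2.2 G}) =
      (cell S k j).indicator (fun x => envLaw S {e | ENNReal.ofReal T ≤ sinr S x e G}) x := by
    intro x
    by_cases hx : x ∈ cell S k j
    · have : Prod.mk x ⁻¹' {w : ℝ × ℝ × Env | w.1 ∈ cell S k j ∧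
          ENNReal.ofReal T ≤ sinr S w.1 w.2.2 G} =
          univ ×ˢ {e | ENNReal.ofReal T ≤ sinr S x e G} := by
        ext w
        simp [hx]
      rw [this, Measure.prod_prod, measure_univ, one_mul, indicator_of_mem hx]
    · have : Prod.mk x ⁻¹' {w : ℝ × ℝ × Env | w.1 ∈ cell S k j ∧
          ENNReal.ofReal T ≤ sinr S w.1 w.2.2 G} = ∅ := by
        ext w
        simp [hx]
      rw [this, measure_empty, indicator_of_notMem hx]
  rw [measureReal_def, Measure.prod_apply hmeas, lintegral_congr hsec, lintegral_indicator hcell]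
  refine (integral_toReal ?_ (ae_of_all _ fun x => measure_lt_top _ _)).symm
  exact (measurable_measure_prodMk_left (measurableSet_covered S T G)).aemeasurable

lemma setIntegral_distLaw (k : ℕ) {j : ℕ} (hj : j < k) (f : ℝ → ℝ) :
    ∫ x in cell S k j, f x ∂distLaw S = ∫ x in (dL S k j)..(dR S k j), f x * fd S x := by
  rw [cell, distLaw, setIntegral_withDensity_eq_setIntegral_toReal_smul
    (measurable_fd S).ennreal_ofReal (ae_of_all _ fun x => ENNReal.ofReal_lt_top) f
    measurableSet_Ico, intervalIntegral.integral_of_le (dL_le_dR S hj),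
    integral_Ico_eq_integral_Ioc]
  refine integral_congr_ae (ae_of_all _ fun x => ?_)
  simp only [ENNReal.toReal_ofReal (fd_nonneg S x), smul_eq_mul, mul_comm]

/-- `T0` does not depend on the angle, so the density `fpsi` integrates out. -/
lemma errorFree_eq (k j : ℕ) (T0 : ℝ → ℝ) :
    errorFree S k j T0 = ∫ x in (dL S k j)..(dR S k j), T0 x * fd S x := by
  simp only [errorFree, intervalIntegral.integral_mul_const, intervalIntegral.integral_const_mul,
    integral_fpsi, mul_one]

/-- Under exhaustive search the SINR coverage probability is the average of the error-free
conditional coverage probability. -/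
lemma IsExhaustiveSearch.coverage_eq_errorFree {S : Network} {k M : ℕ} {sel : Selection k M}
    (hsel : IsExhaustiveSearch S sel) (T : ℝ) (j : Fin k) :
    coverage S sel T j =
      errorFree S k j (condCoverage S T (gain0 S (thetaB S k) (thetaU M))) := by
  rw [errorFree_eq, ← setIntegral_distLaw S k j.2, ← measureReal_cell_covered, coverage]
  -- Almost sure equality replaces the event by one with constant gain, which is measurable; no
  -- measurability of `sel` is required.
  refine measureReal_congr ?_
  have hψ : ∀ᵐ w ∂(distLaw S).prod (aoaLaw.prod (envLaw S)),
      w.2.1 ∈ Ico (0 : ℝ) (2 * Real.pi) :=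
    (Measure.quasiMeasurePreserving_fst.comp Measure.quasiMeasurePreserving_snd).ae ae_aoaLaw_mem
  have hf : ∀ᵐ w ∂(distLaw S).prod (aoaLaw.prod (envLaw S)),
      0 < w.2.2.2.1 0 ∧ 0 < w.2.2.2.2 0 :=
    (Measure.quasiMeasurePreserving_snd.comp Measure.quasiMeasurePreserving_snd).ae
      (ae_fading_pos S)
  filter_upwards [hψ, hf] with w hwψ hwf
  refine propext (and_congr_right fun hx => ?_)
  obtain ⟨h1, h2⟩ := hsel.selected hx hwψ hwf.1 hwf.2
  have hgB : gainB S k (sel w.1 w.2.1 w.2.2).1 w.1 = mainGain S (thetaB S k) := by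
    rw [h1]
    exact if_pos hx
  have hgU : gainU S M (sel w.1 w.2.1 w.2.2).2 w.2.1 = mainGain S (thetaU M) := if_pos h2
  rw [hgB, hgU, gain0]

end MmWave

end


theorem proposition1 (S : MmWave.Network) (k M : ℕ) (ν : ℝ → ℝ → ℝ)
    (hν : MmWave.thetaU M / 2 ≤ ν (MmWave.thetaB S k) (MmWave.thetaU M))
    (sel : MmWave.Selection k M) (hsel : MmWave.IsExhaustiveSearch S sel)
    (T : ℝ) (hT : 0 < T) (j : Fin k) :
    -- no beam-selection error
    (∀ x ∈ MmWave.cell S k j, ∀ ψ ∈ Ico (0 : ℝ) (2 * Real.pi),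
      MmWave.probBS S sel j x ψ = 0) ∧
    -- no misalignment error (if the threshold is exactly half the beamwidth, the angles at which
    -- two neighbouring user beams meet, where the separation equals the threshold, are excepted)
    (∀ x ∈ MmWave.cell S k j, ∀ ψ ∈ Ico (0 : ℝ) (2 * Real.pi),
      (MmWave.thetaU M / 2 < ν (MmWave.thetaB S k) (MmWave.thetaU M) ∨
        ∀ m : ℕ, ψ ≠ m * MmWave.thetaU M) →
      MmWave.probMA S sel (ν (MmWave.thetaB S k) (MmWave.thetaU M)) x ψ = 0) ∧
    -- the SINR coverage probability is given by the mixture of the three conditional coverage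
    -- probabilities, which reduces to the integral of the error-free one
    (MmWave.coverage S sel T j =
        MmWave.mixture S k j
          (MmWave.condCoverage S T
            (MmWave.gain0 S (MmWave.thetaB S k) (MmWave.thetaU M)))
          (MmWave.condCoverage S T (MmWave.gainMA S (MmWave.thetaB S k)))
          (MmWave.condCoverage S T (MmWave.gainBS S))
          (MmWave.probBS S sel j)
          (MmWave.probMA S sel (ν (MmWave.thetaB S k) (MmWave.thetaU M))) ∧
      MmWave.coverage S sel T j =
        MmWave.errorFree S k j
          (MmWave.condCoverage S T
            (MmWave.gain0 S (MmWave.thetaB S k) (MmWave.thetaU M)))) ∧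
    -- the same reduction for the closed-form expressions
    MmWave.mixture S k j
        (MmWave.formula0 S T (MmWave.thetaB S k) (MmWave.thetaU M))
        (MmWave.formulaMA S T (MmWave.thetaB S k))
        (MmWave.formulaBS S T)
        (MmWave.probBS S sel j)
        (MmWave.probMA S sel (ν (MmWave.thetaB S k) (MmWave.thetaU M))) =
      MmWave.errorFree S k j
        (MmWave.formula0 S T (MmWave.thetaB S k) (MmWave.thetaU M)) := by
  -- A single reduction serves both the conditional probabilities and the closed forms, since the
  -- three functions are arbitrary.
  have hmix := fun T0 TMA TBS => hsel.mixture_eq_errorFree j hν T0 TMA TBS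
  have hcov := hsel.coverage_eq_errorFree T j
  exact ⟨fun x hx ψ hψ => hsel.probBS_eq_zero hx hψ,
    fun x hx ψ hψ h => hsel.probMA_eq_zero hν hx hψ h,
    ⟨hcov.trans (hmix _ _ _).symm, hcov⟩, hmix _ _ _⟩
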